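/- Let $K$ be a field and $h\ge 2$ an integer. In $K[x_0,x_1,x_2,x_3,x_4]$ consider the binomials $$w=x_2x_3-x_1x_4,$$ $$g_i=x_1^{i}x_3^{h-i+1}-x_2^{i+1}x_4^{h-i}\quad(0\le i\le h-1),\qquad g_h=x_2^{h+1}-x_1^{h}x_3,$$ $$q_j=x_1^{j+1}x_2^{h-j}-x_3^{j}x_4^{h-j}x_0\quad(0\le j\le h).$$ Put $n_0=0$, $n_1=h(h+1)$, $n_2=h(h+1)+1$, $n_3=(h+1)^2$, $n_4=(h+1)^2+1$. Let $\overline{\mathfrak I_h}$ be the defining ideal of the projective closure of Arslan's curve $\mathfrak A_h=C(n_1,n_2,n_3,n_4)=\{(b^{n_1},b^{n_2},b^{n_3},b^{n_4})\}$, that is, the kernel of the $K$-algebra homomorphism $$K[x_0,\dots,x_4]\to K[s,t],\qquad x_i\mapsto t^{n_i}s^{n_4-n_i}\quad(0\le i\le 4).$$ Then the set $$\mathfrak U_h=\{w\}\cup\{g_i\mid 0\le i\le h\}\cup\{q_j\mid 0\le j\le h\}$$ is a Gröbner basis of $\overline{\mathfrak I_h}$ with respect to the degree reverse lexicographic monomial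 order with $x_1>x_2>x_3>x_4>x_0$; that is, $\mathfrak U_h$ is a finite subset of $\overline{\mathfrak I_h}$ and the leading terms of its elements generate the ideal generated by the leading terms of all elements of $\overline{\mathfrak I_h}$. -/

import Mathlib

namespace Arslan

/-- A type synonym for the exponents of monomials in the variables `v 0, …, v (n - 1)`, to be
ordered by the degree reverse lexicographic order with `v 0 > v 1 > ⋯ > v (n - 1)`. -/
def DegRevLexSyn {σ : Type*} {n : ℕ} (_v : Fin n ≃ σ) : Type _ := σ →₀ ℕ

noncomputable instance {σ : Type*} {n : ℕ} (v : Fin n ≃ σ) : AddCommMonoid (DegRevLexSyn v) :=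
  inferInstanceAs (AddCommMonoid (σ →₀ ℕ))

/-- The identity, as an additive equivalence onto the type synonym. -/
noncomputable def toDegRevLexSyn {σ : Type*} {n : ℕ} (v : Fin n ≃ σ) :
    (σ →₀ ℕ) ≃+ DegRevLexSyn v where
  toFun a := a
  invFun a := a
  left_inv _ := rfl
  right_inv _ := rfl
  map_add' _ _ := rfl

/-- The sorting key of an exponent: first its total degree; in case of a tie, the exponents listed
from the smallest variable to the largest one, compared lexicographically and reversed. -/
noncomputable def degRevLexKey {σ : Type*} {n : ℕ} (v : Fin n ≃ σ) (a : σ →₀ ℕ) :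
    ℕ ×ₗ (Lex (Fin n → ℕ))ᵒᵈ :=
  toLex (a.degree, OrderDual.toDual (toLex fun j : Fin n => a (v j.rev)))

theorem degRevLexKey_injective {σ : Type*} {n : ℕ} (v : Fin n ≃ σ) :
    Function.Injective (degRevLexKey v) := by
  intro a b hab
  have h2 : (fun j : Fin n => a (v j.rev)) = fun j : Fin n => b (v j.rev) :=
    congrArg (fun p => (ofLex p).2) hab
  refine Finsupp.ext fun i => ?_
  simpa using congrFun h2 (v.symm i).rev

noncomputable instance {σ : Type*} {n : ℕ} (v : Fin n ≃ σ) : LinearOrder (DegRevLexSyn v) :=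
  LinearOrder.lift' (fun a => degRevLexKey v ((toDegRevLexSyn v).symm a))
    ((degRevLexKey_injective v).comp (toDegRevLexSyn v).symm.injective)

theorem toDegRevLexSyn_lt_iff {σ : Type*} {n : ℕ} (v : Fin n ≃ σ) (a b : σ →₀ ℕ) :
    toDegRevLexSyn v a < toDegRevLexSyn v b ↔
      a.degree < b.degree ∨ (a.degree = b.degree ∧
        ∃ i : Fin n, b (v i) < a (v i) ∧ ∀ j, i < j → a (v j) = b (v j)) := by
  change degRevLexKey v a < degRevLexKey v b ↔ _
  rw [Prod.Lex.lt_iff]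
  refine or_congr Iff.rfl (and_congr Iff.rfl ?_)
  change (∃ i : Fin n, (∀ j < i, b (v j.rev) = a (v j.rev)) ∧ b (v i.rev) < a (v i.rev)) ↔ _
  constructor
  · rintro ⟨i, h1, h2⟩
    refine ⟨i.rev, h2, fun j hj => ?_⟩
    have := h1 j.rev (by rw [← Fin.rev_lt_rev]; simpa using hj)
    simpa using this.symm
  · rintro ⟨i, h1, h2⟩
    refine ⟨i.rev, fun j hj => ?_, by simpa using h1⟩
    exact (h2 j.rev (by rw [← Fin.rev_lt_rev]; simpa using hj)).symm

instance {σ : Type*} {n : ℕ} (v : Fin n ≃ σ) : IsOrderedAddMonoid (DegRevLexSyn v) where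
  add_le_add_left a b hab c := by
    obtain ⟨a, rfl⟩ := (toDegRevLexSyn v).surjective a
    obtain ⟨b, rfl⟩ := (toDegRevLexSyn v).surjective b
    obtain ⟨c, rfl⟩ := (toDegRevLexSyn v).surjective c
    rcases eq_or_lt_of_le hab with heq | hlt
    · rw [heq]
    · rw [← map_add, ← map_add]
      refine le_of_lt ?_
      rw [toDegRevLexSyn_lt_iff] at hlt ⊢
      simpa [map_add] using hlt

theorem toDegRevLexSyn_monotone {σ : Type*} {n : ℕ} (v : Fin n ≃ σ) :
    Monotone (toDegRevLexSyn v) := by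
  intro a b hab
  obtain ⟨c, rfl⟩ := exists_add_of_le hab
  rcases eq_or_ne c 0 with rfl | hc
  · rw [add_zero]
  · refine le_of_lt ((toDegRevLexSyn_lt_iff v a (a + c)).2 (Or.inl ?_))
    rw [map_add]
    have : c.degree ≠ 0 := by rwa [Ne, Finsupp.degree_eq_zero_iff]
    omega

instance {σ : Type*} {n : ℕ} (v : Fin n ≃ σ) : WellFoundedLT (DegRevLexSyn v) := by
  have : Finite σ := Finite.of_equiv _ v
  rw [← wellQuasiOrderedLE_iff_wellFoundedLT]
  refine ⟨fun f => ?_⟩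
  obtain ⟨i, j, hij, h⟩ :=
    wellQuasiOrdered_le (α := σ →₀ ℕ) fun k => (toDegRevLexSyn v).symm (f k)
  exact ⟨i, j, hij, toDegRevLexSyn_monotone v h⟩

/-- The degree reverse lexicographic monomial order with `v 0 > v 1 > ⋯ > v (n - 1)`. -/
noncomputable def degRevLex {σ : Type*} {n : ℕ} (v : Fin n ≃ σ) : MonomialOrder σ where
  syn := DegRevLexSyn v
  toSyn := toDegRevLexSyn v
  toSyn_monotone := toDegRevLexSyn_monotone v

open scoped MonomialOrder in
/-- `x ^ a < x ^ b` iff `a` has smaller total degree, or the total degrees agree and, at the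
smallest variable where the exponents differ, `a` has the larger exponent. -/
theorem degRevLex_lt_iff {σ : Type*} {n : ℕ} (v : Fin n ≃ σ) (a b : σ →₀ ℕ) :
    a ≺[degRevLex v] b ↔
      a.degree < b.degree ∨ (a.degree = b.degree ∧
        ∃ i : Fin n, b (v i) < a (v i) ∧ ∀ j, i < j → a (v j) = b (v j)) :=
  toDegRevLexSyn_lt_iff v a b

/-- `G` is a (finite) Gröbner basis of the ideal `I` with respect to the monomial order `m`:
`G` is contained in `I`, and the leading terms of the elements of `G` generate the initial ideal
of `I`. -/
def IsGroebnerBasis {σ K : Type*} [Field K] (m : MonomialOrder σ)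
    (G : Set (MvPolynomial σ K)) (I : Ideal (MvPolynomial σ K)) : Prop :=
  G.Finite ∧ G ⊆ (I : Set (MvPolynomial σ K)) ∧
    Ideal.span (m.leadingTerm '' G) = Ideal.span (m.leadingTerm '' (I : Set (MvPolynomial σ K)))

open MvPolynomial in
/-- For exponents `n₁, …, n_r` (with `n_r` the largest one) and `n₀ = 0`, the map
`K[x₀, …, x_r] → K[s, t]`, `xᵢ ↦ t ^ nᵢ * s ^ (n_r - nᵢ)`, where `s = X 0` and `t = X 1`. -/
noncomputable def projParam (K : Type*) [Field K] {r : ℕ} (n : Fin r → ℕ) :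
    MvPolynomial (Fin (r + 1)) K →ₐ[K] MvPolynomial (Fin 2) K :=
  let n' : Fin (r + 1) → ℕ := Fin.cons 0 n
  aeval fun i => X 1 ^ n' i * X 0 ^ (n' (Fin.last r) - n' i)

/-- The defining ideal of the projective closure of the affine monomial curve
`C(n₁, …, n_r) = {(b ^ n₁, …, b ^ n_r)}`. -/
noncomputable def projClosureIdeal (K : Type*) [Field K] {r : ℕ} (n : Fin r → ℕ) :
    Ideal (MvPolynomial (Fin (r + 1)) K) :=
  RingHom.ker (projParam K n)

/-- The exponents of Arslan's curve. -/
def arslanExponents (h : ℕ) : Fin 4 → ℕ :=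
  ![h * (h + 1), h * (h + 1) + 1, (h + 1) ^ 2, (h + 1) ^ 2 + 1]

/-- The variables `x₁, x₂, x₃, x₄, x₀`, in this order, where `xᵢ = X i`. -/
def varOrder : Fin 5 ≃ Fin 5 where
  toFun := ![1, 2, 3, 4, 0]
  invFun := ![4, 0, 1, 2, 3]
  left_inv := by decide
  right_inv := by decide

open MvPolynomial in
/-- The binomial `w`. -/
noncomputable def w (K : Type*) [Field K] : MvPolynomial (Fin 5) K :=
  X 2 * X 3 - X 1 * X 4

open MvPolynomial in
/-- The binomials `g₀, …, g_h`, with a separate sign convention for `g_h`. -/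
noncomputable def g (K : Type*) [Field K] (h i : ℕ) : MvPolynomial (Fin 5) K :=
  if i < h then X 1 ^ i * X 3 ^ (h - i + 1) - X 2 ^ (i + 1) * X 4 ^ (h - i)
  else X 2 ^ (h + 1) - X 1 ^ h * X 3

open MvPolynomial in
/-- The binomials `q₀, …, q_h`. -/
noncomputable def q (K : Type*) [Field K] (h j : ℕ) : MvPolynomial (Fin 5) K :=
  X 1 ^ (j + 1) * X 2 ^ (h - j) - X 3 ^ j * X 4 ^ (h - j) * X 0

/-- The set of all `w`, `gᵢ`, `qⱼ`, `0 ≤ i, j ≤ h`. -/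
noncomputable def basisSet (K : Type*) [Field K] (h : ℕ) : Set (MvPolynomial (Fin 5) K) :=
  {w K} ∪ {f | ∃ i ≤ h, f = g K h i} ∪ {f | ∃ j ≤ h, f = q K h j}

end Arslan

/-!
Two monomials have the same image in `K[s, t]` iff they lie in the same fibre of an additive map
on exponents. The leading monomial of a nonzero element of the kernel is never the smallest
monomial of its fibre, since its image must cancel. The smallest monomial of a fibre, in turn, is
standard: it is divisible by no leading monomial of a binomial of the kernel. Hence binomials of
the kernel form a Gröbner basis as soon as every fibre contains only one standard monomial.

For Arslan's curve, a standard monomial satisfies `a₂ = 0 ∨ a₃ = 0`, and the exponent of `s` in its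
image is `((h + 1) ^ 2 + 1) * a₀ + (h + 1) * (a₁ + a₂) + (a₁ + a₃)`. Reading off digits gives `a₀`,
`a₁ + a₂` and `a₁ + a₃`, hence `a₁`, `a₂` and `a₃`; the exponent of `t` then gives `a₄`.
-/

namespace Arslan

open MvPolynomial
open Finsupp (linearCombination)
open scoped MonomialOrder

section Binomial

variable {σ R : Type*} [CommRing R]

variable (R) in
/-- The binomial `x ^ u - x ^ v` attached to a pair `(u, v)` of exponents; throughout, `u` is meant
to be the leading one. -/
noncomputable def binomial (p : (σ →₀ ℕ) × (σ →₀ ℕ)) : MvPolynomial σ R :=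
  monomial p.1 1 - monomial p.2 1

variable [Nontrivial R] (m : MonomialOrder σ) {p : (σ →₀ ℕ) × (σ →₀ ℕ)}

theorem degree_binomial (hp : p.2 ≺[m] p.1) : m.degree (binomial R p) = p.1 := by
  classical
  rw [binomial, m.degree_sub_of_lt, m.degree_monomial, if_neg one_ne_zero]
  simpa [m.degree_monomial] using hp

theorem binomial_ne_zero (hp : p.2 ≠ p.1) : binomial R p ≠ 0 := by
  rw [binomial, sub_ne_zero]
  exact fun h => hp (monomial_left_injective one_ne_zero h).symm

end Binomial

theorem isGroebnerBasis_of_exists_degree_le {σ K : Type*} [Field K] {m : MonomialOrder σ}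
    {G : Set (MvPolynomial σ K)} {I : Ideal (MvPolynomial σ K)} (hfin : G.Finite)
    (hGI : G ⊆ (I : Set (MvPolynomial σ K)))
    (hred : ∀ f ∈ I, f ≠ 0 → ∃ p ∈ G, p ≠ 0 ∧ m.degree p ≤ m.degree f) :
    IsGroebnerBasis m G I := by
  refine ⟨hfin, hGI, le_antisymm (Ideal.span_mono (Set.image_mono hGI)) ?_⟩
  rw [m.span_leadingTerm_eq_span_monomial', m.span_leadingTerm_eq_span_monomial', Ideal.span_le]
  rintro _ ⟨f, ⟨hfI, hf0⟩, rfl⟩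
  obtain ⟨p, hpG, hp0, hle⟩ := hred f hfI hf0
  exact Ideal.mem_of_dvd _ (monomial_one_dvd_monomial_one.2 hle)
    (Ideal.subset_span ⟨p, ⟨hpG, hp0⟩, rfl⟩)

section ToricIdeal

variable {σ τ : Type*}

/-- The monomial map sending the variable `i` to the monomial with exponent `A i`; on exponents it
is `linearCombination ℕ A`. -/
noncomputable def toricMap (R : Type*) [CommSemiring R] (A : σ → τ →₀ ℕ) :
    MvPolynomial σ R →ₐ[R] MvPolynomial τ R :=
  aeval fun i => monomial (A i) 1

/-- The toric ideal of a family `A` of exponents: the kernel of its monomial map. -/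
noncomputable def toricIdeal (R : Type*) [CommSemiring R] (A : σ → τ →₀ ℕ) :
    Ideal (MvPolynomial σ R) :=
  RingHom.ker (toricMap R A)

/-- The exponents of the standard monomials of a family `B` of binomials: those divisible by no
leading monomial of `B`. -/
def standardExponents (B : Set ((σ →₀ ℕ) × (σ →₀ ℕ))) : Set (σ →₀ ℕ) :=
  {a | ∀ p ∈ B, ¬ p.1 ≤ a}

theorem linearCombination_apply_eq_sum [Fintype σ] (A : σ → τ →₀ ℕ) (a : σ →₀ ℕ)
    (j : τ) : linearCombination ℕ A a j = ∑ i, a i * A i j := by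
  rw [Finsupp.linearCombination_apply, Finsupp.sum_fintype _ _ fun i => zero_smul ℕ (A i),
    Finsupp.finsetSum_apply]
  simp only [Finsupp.smul_apply, smul_eq_mul]

theorem toricMap_monomial {R : Type*} [CommSemiring R] (A : σ → τ →₀ ℕ) (a : σ →₀ ℕ) (c : R) :
    toricMap R A (monomial a c) = monomial (linearCombination ℕ A a) c := by
  rw [toricMap, aeval_monomial, Finsupp.linearCombination_apply, monomial_finsupp_sum_index]
  simp only [monomial_pow, one_pow, algebraMap_eq]

theorem coeff_toricMap [DecidableEq τ] {R : Type*} [CommSemiring R] (A : σ → τ →₀ ℕ)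
    (f : MvPolynomial σ R) (b : τ →₀ ℕ) :
    coeff b (toricMap R A f) = ∑ a ∈ f.support with linearCombination ℕ A a = b, coeff a f := by
  conv_lhs => rw [f.as_sum, map_sum, coeff_sum]
  simp only [toricMap_monomial, coeff_monomial, Finset.sum_filter]

theorem binomial_mem_toricIdeal {R : Type*} [CommRing R] {A : σ → τ →₀ ℕ}
    {p : (σ →₀ ℕ) × (σ →₀ ℕ)} (hp : linearCombination ℕ A p.1 = linearCombination ℕ A p.2) :
    binomial R p ∈ toricIdeal R A := by
  rw [toricIdeal, RingHom.mem_ker, binomial, map_sub, toricMap_monomial, toricMap_monomial, hp,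
    sub_self]

theorem exists_lt_degree_of_mem_toricIdeal {R : Type*} [CommSemiring R] (m : MonomialOrder σ)
    {A : σ → τ →₀ ℕ} {f : MvPolynomial σ R} (hf : f ∈ toricIdeal R A) (hf0 : f ≠ 0) :
    ∃ a, a ≺[m] m.degree f ∧ linearCombination ℕ A a = linearCombination ℕ A (m.degree f) := by
  classical
  by_contra! hsmallest
  have hfiber : {a ∈ f.support | linearCombination ℕ A a = linearCombination ℕ A (m.degree f)} =
      {m.degree f} := by
    ext a
    rw [Finset.mem_filter, Finset.mem_singleton]
    constructor
    · rintro ⟨ha, haA⟩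
      by_contra hne
      exact hsmallest a (lt_of_le_of_ne (m.le_degree ha) (m.toSyn.injective.ne hne)) haA
    · rintro rfl
      exact ⟨m.degree_mem_support hf0, rfl⟩
  have hcoeff := coeff_toricMap A f (linearCombination ℕ A (m.degree f))
  rw [hfiber, Finset.sum_singleton, RingHom.mem_ker.1 hf, coeff_zero] at hcoeff
  exact m.coeff_degree_ne_zero_iff.2 hf0 hcoeff.symm

theorem exists_smallest_standardExponent_in_fiber (m : MonomialOrder σ) {A : σ → τ →₀ ℕ}
    {B : Set ((σ →₀ ℕ) × (σ →₀ ℕ))} (hlt : ∀ p ∈ B, p.2 ≺[m] p.1)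
    (hA : ∀ p ∈ B, linearCombination ℕ A p.1 = linearCombination ℕ A p.2) (a : σ →₀ ℕ) :
    ∃ b ∈ standardExponents B, linearCombination ℕ A b = linearCombination ℕ A a ∧
      ∀ c, linearCombination ℕ A c = linearCombination ℕ A a → b ≼[m] c := by
  set fiber : Set (σ →₀ ℕ) := {c | linearCombination ℕ A c = linearCombination ℕ A a}
  obtain ⟨b, hb, hmin⟩ : ∃ b ∈ fiber, ∀ c ∈ fiber, b ≼[m] c :=
    ⟨_, Function.argminOn_mem m.toSyn fiber ⟨a, rfl⟩,
      fun _ hc => Function.argminOn_le m.toSyn fiber hc⟩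
  refine ⟨b, fun p hp hle => ?_, hb, hmin⟩
  obtain ⟨c, rfl⟩ := exists_add_of_le hle
  have hmem : p.2 + c ∈ fiber := by
    simpa only [fiber, Set.mem_ofPred_eq, map_add, hA p hp] using hb
  have hsmaller : p.2 + c ≺[m] p.1 + c := by
    simpa only [map_add] using add_lt_add_left (hlt p hp) _
  exact (hmin _ hmem).not_gt hsmaller

theorem isGroebnerBasis_toricIdeal {K : Type*} [Field K] {m : MonomialOrder σ} {A : σ → τ →₀ ℕ}
    {B : Set ((σ →₀ ℕ) × (σ →₀ ℕ))} (hfin : B.Finite) (hlt : ∀ p ∈ B, p.2 ≺[m] p.1)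
    (hA : ∀ p ∈ B, linearCombination ℕ A p.1 = linearCombination ℕ A p.2)
    (hinj : Set.InjOn (linearCombination ℕ A) (standardExponents B)) :
    IsGroebnerBasis m (binomial K '' B) (toricIdeal K A) := by
  refine isGroebnerBasis_of_exists_degree_le (hfin.image _) ?_ fun f hf hf0 => ?_
  · rintro _ ⟨p, hp, rfl⟩
    exact binomial_mem_toricIdeal (hA p hp)
  have hnot : m.degree f ∉ standardExponents B := by
    intro hstd
    obtain ⟨a, ha, haA⟩ := exists_lt_degree_of_mem_toricIdeal m hf hf0
    obtain ⟨b, hb, hbA, hmin⟩ := exists_smallest_standardExponent_in_fiber m hlt hA (m.degree f)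
    have hle := hmin a haA
    rw [hinj hb hstd hbA] at hle
    exact hle.not_gt ha
  obtain ⟨p, hp, hle⟩ : ∃ p ∈ B, p.1 ≤ m.degree f := by
    simpa only [standardExponents, Set.mem_ofPred_eq, not_forall, not_not, exists_prop] using hnot
  refine ⟨_, ⟨p, hp, rfl⟩, binomial_ne_zero ?_, by rwa [degree_binomial m (hlt p hp)]⟩
  exact fun heq => (hlt p hp).ne (congrArg m.toSyn heq)

end ToricIdeal

theorem degRevLex_lt_of_degree_eq {σ : Type*} {n : ℕ} {v : Fin n ≃ σ} {a b : σ →₀ ℕ} (i : Fin n)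
    (hdeg : a.degree = b.degree) (hi : b (v i) < a (v i)) (heq : ∀ j, i < j → a (v j) = b (v j)) :
    a ≺[degRevLex v] b :=
  (degRevLex_lt_iff v a b).2 (Or.inr ⟨hdeg, i, hi, heq⟩)

section ProjectiveClosure

variable {r : ℕ} (n : Fin r → ℕ)

/-- The exponent of the image `t ^ nᵢ * s ^ (n_r - nᵢ)` of the variable `xᵢ` under `projParam`. -/
noncomputable def projExponent (i : Fin (r + 1)) : Fin 2 →₀ ℕ :=
  let n' : Fin (r + 1) → ℕ := Fin.cons 0 n
  Finsupp.single 1 (n' i) + Finsupp.single 0 (n' (Fin.last r) - n' i)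

theorem projClosureIdeal_eq_toricIdeal (K : Type*) [Field K] :
    projClosureIdeal K n = toricIdeal K (projExponent n) := by
  simp only [projClosureIdeal, projParam, toricIdeal, toricMap, projExponent, X_pow_eq_monomial,
    monomial_mul, mul_one]

end ProjectiveClosure

theorem eq_and_eq_of_mul_add_eq_mul_add {n u v u' v' : ℕ} (hv : v < n) (hv' : v' < n)
    (heq : n * u + v = n * u' + v') : u = u' ∧ v = v' := by
  have hn : 0 < n := Nat.zero_lt_of_lt hv
  obtain ⟨hdiv, hmod⟩ := (Nat.div_mod_unique hn).2 ⟨Nat.add_comm v (n * u), hv⟩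
  obtain ⟨hdiv', hmod'⟩ := (Nat.div_mod_unique hn).2 ⟨Nat.add_comm v' (n * u'), hv'⟩
  exact ⟨by rw [← hdiv, ← hdiv', heq], by rw [← hmod, ← hmod', heq]⟩

-- The last digit `n` is allowed for the sake of the standard monomial `x₁ ^ h * x₃`.
theorem le_of_mul_add_eq_mul_add {n u v u' v' : ℕ} (hv : v ≤ n) (hlast : v = n → u + 1 = n)
    (hu' : u' < n) (heq : n * u + v = n * u' + v') : u' ≤ u := by
  by_contra! hlt
  have hmul : n * u + n ≤ n * u' := Nat.mul_le_mul_left n hlt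
  have hv_eq : v = n := by omega
  have := hlast hv_eq
  omega

section ArslanCurve

variable (h : ℕ)

/-- The exponent of the image in `K[s, t]` of a monomial, under the parametrization of the
projective closure of Arslan's curve; the entries `0` and `1` belong to `s` and `t`. -/
noncomputable abbrev imageExponent : (Fin 5 →₀ ℕ) →ₗ[ℕ] Fin 2 →₀ ℕ :=
  linearCombination ℕ (projExponent (arslanExponents h))

theorem projExponent_arslanExponents_zero (i : Fin 5) :
    projExponent (arslanExponents h) i 0 = ![(h + 1) ^ 2 + 1, h + 2, h + 1, 1, 0] i := by
  have hsub_one : (h + 1) ^ 2 + 1 - h * (h + 1) = h + 2 := Nat.sub_eq_of_eq_add (by ring)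
  have hsub_two : (h + 1) ^ 2 + 1 - (h * (h + 1) + 1) = h + 1 := Nat.sub_eq_of_eq_add (by ring)
  fin_cases i <;> simp [projExponent, arslanExponents, hsub_one, hsub_two]

theorem projExponent_arslanExponents_one (i : Fin 5) :
    projExponent (arslanExponents h) i 1 =
      ![0, h * (h + 1), h * (h + 1) + 1, (h + 1) ^ 2, (h + 1) ^ 2 + 1] i := by
  fin_cases i <;> simp [projExponent, arslanExponents]

theorem imageExponent_apply_zero (a : Fin 5 →₀ ℕ) :
    imageExponent h a 0 =
      ((h + 1) ^ 2 + 1) * a 0 + ((h + 1) * (a 1 + a 2) + (a 1 + a 3)) := by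
  simp only [linearCombination_apply_eq_sum, projExponent_arslanExponents_zero,
    Fin.sum_univ_five, Matrix.cons_val]
  ring

theorem imageExponent_apply_one (a : Fin 5 →₀ ℕ) :
    imageExponent h a 1 =
      h * (h + 1) * a 1 + (h * (h + 1) + 1) * a 2 + (h + 1) ^ 2 * a 3 +
        ((h + 1) ^ 2 + 1) * a 4 := by
  simp only [linearCombination_apply_eq_sum, projExponent_arslanExponents_one,
    Fin.sum_univ_five, Matrix.cons_val]
  ring

theorem imageExponent_eq_iff {a b : Fin 5 →₀ ℕ} :
    imageExponent h a = imageExponent h b ↔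
      ((h + 1) ^ 2 + 1) * a 0 + ((h + 1) * (a 1 + a 2) + (a 1 + a 3)) =
          ((h + 1) ^ 2 + 1) * b 0 + ((h + 1) * (b 1 + b 2) + (b 1 + b 3)) ∧
        h * (h + 1) * a 1 + (h * (h + 1) + 1) * a 2 + (h + 1) ^ 2 * a 3 + ((h + 1) ^ 2 + 1) * a 4 =
          h * (h + 1) * b 1 + (h * (h + 1) + 1) * b 2 + (h + 1) ^ 2 * b 3 +
            ((h + 1) ^ 2 + 1) * b 4 := by
  simp only [DFunLike.ext_iff, Fin.forall_fin_two, imageExponent_apply_zero,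
    imageExponent_apply_one]

/-- The exponent of the monomial `x₀ ^ e * x₁ ^ a * x₂ ^ b * x₃ ^ c * x₄ ^ d`. -/
noncomputable def exponent (e a b c d : ℕ) : Fin 5 →₀ ℕ :=
  Finsupp.equivFunOnFinite.symm ![e, a, b, c, d]

section Exponent

variable (e a b c d : ℕ)

@[simp] theorem exponent_zero : exponent e a b c d 0 = e := rfl
@[simp] theorem exponent_one : exponent e a b c d 1 = a := rfl
@[simp] theorem exponent_two : exponent e a b c d 2 = b := rfl
@[simp] theorem exponent_three : exponent e a b c d 3 = c := rfl
@[simp] theorem exponent_four : exponent e a b c d 4 = d := rfl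

theorem exponent_le_iff {f : Fin 5 →₀ ℕ} :
    exponent e a b c d ≤ f ↔ e ≤ f 0 ∧ a ≤ f 1 ∧ b ≤ f 2 ∧ c ≤ f 3 ∧ d ≤ f 4 := by
  rw [Finsupp.le_def]
  simp [Fin.forall_fin_succ]

theorem degree_exponent : (exponent e a b c d).degree = e + a + b + c + d := by
  simp [Finsupp.degree_eq_sum, Fin.sum_univ_five]

theorem monomial_exponent (R : Type*) [CommSemiring R] :
    monomial (exponent e a b c d) (1 : R) = X 0 ^ e * X 1 ^ a * X 2 ^ b * X 3 ^ c * X 4 ^ d := by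
  rw [monomial_eq, Finsupp.prod_fintype _ _ fun _ => pow_zero _, Fin.prod_univ_five]
  simp

end Exponent

/-- The leading and the trailing exponent of `w`. -/
noncomputable def wExponents : (Fin 5 →₀ ℕ) × (Fin 5 →₀ ℕ) :=
  (exponent 0 0 1 1 0, exponent 0 1 0 0 1)

/-- The leading and the trailing exponent of `gᵢ`. -/
noncomputable def gExponents (i : ℕ) : (Fin 5 →₀ ℕ) × (Fin 5 →₀ ℕ) :=
  if i < h then (exponent 0 i 0 (h - i + 1) 0, exponent 0 0 (i + 1) 0 (h - i))
  else (exponent 0 0 (h + 1) 0 0, exponent 0 h 0 1 0)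

/-- The leading and the trailing exponent of `qⱼ`. -/
noncomputable def qExponents (j : ℕ) : (Fin 5 →₀ ℕ) × (Fin 5 →₀ ℕ) :=
  (exponent 0 (j + 1) (h - j) 0 0, exponent 1 0 0 j (h - j))

/-- The pairs of leading and trailing exponents of the elements of `basisSet`. -/
def basisExponents : Set ((Fin 5 →₀ ℕ) × (Fin 5 →₀ ℕ)) :=
  {wExponents} ∪ gExponents h '' Set.Iic h ∪ qExponents h '' Set.Iic h

variable {h}

theorem forall_mem_basisExponents {P : (Fin 5 →₀ ℕ) × (Fin 5 →₀ ℕ) → Prop} :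
    (∀ p ∈ basisExponents h, P p) ↔
      P (exponent 0 0 1 1 0, exponent 0 1 0 0 1) ∧
      P (exponent 0 0 (h + 1) 0 0, exponent 0 h 0 1 0) ∧
      (∀ i < h, P (exponent 0 i 0 (h - i + 1) 0, exponent 0 0 (i + 1) 0 (h - i))) ∧
      (∀ j ≤ h, P (exponent 0 (j + 1) (h - j) 0 0, exponent 1 0 0 j (h - j))) := by
  simp only [basisExponents, Set.mem_union, or_imp, forall_and, Set.forall_mem_image,
    Set.mem_Iic, Set.mem_singleton_iff, forall_eq, and_assoc, le_iff_lt_or_eq]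
  grind [wExponents, gExponents, qExponents]

variable (h) in
theorem finite_basisExponents : (basisExponents h).Finite :=
  ((Set.finite_singleton _).union ((Set.finite_Iic h).image _)).union ((Set.finite_Iic h).image _)

section Field

variable (K : Type*) [Field K]

theorem binomial_wExponents : binomial K wExponents = w K := by
  simp [binomial, wExponents, monomial_exponent, w]

variable (h)

theorem binomial_gExponents (i : ℕ) : binomial K (gExponents h i) = g K h i := by
  unfold gExponents g
  split_ifs <;> simp [binomial, monomial_exponent]

theorem binomial_qExponents (j : ℕ) : binomial K (qExponents h j) = q K h j := by
  simp only [binomial, qExponents, monomial_exponent, q]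
  ring

theorem image_binomial_basisExponents : binomial K '' basisExponents h = basisSet K h := by
  ext f
  simp only [basisExponents, basisSet, Set.image_union, Set.image_singleton, Set.image_image,
    binomial_wExponents, binomial_gExponents, binomial_qExponents, Set.mem_union, Set.mem_image,
    Set.mem_Iic, Set.mem_ofPred_eq, eq_comm]

end Field

theorem snd_lt_fst_of_mem_basisExponents :
    ∀ p ∈ basisExponents h, p.2 ≺[degRevLex varOrder] p.1 := by
  rw [forall_mem_basisExponents]
  -- `3`, `2`, `3`, `4` are the positions in `varOrder` of the deciding variables.
  refine ⟨degRevLex_lt_of_degree_eq 3 ?_ ?_ ?_, degRevLex_lt_of_degree_eq 2 ?_ ?_ ?_,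
    fun i hi => degRevLex_lt_of_degree_eq 3 ?_ ?_ ?_,
    fun j _ => degRevLex_lt_of_degree_eq 4 ?_ ?_ ?_⟩ <;>
    simp [degree_exponent, varOrder, Fin.forall_fin_succ] <;> omega

theorem imageExponent_fst_eq_snd_of_mem_basisExponents :
    ∀ p ∈ basisExponents h, imageExponent h p.1 = imageExponent h p.2 := by
  simp only [forall_mem_basisExponents, imageExponent_eq_iff,
    exponent_zero, exponent_one, exponent_two, exponent_three, exponent_four]
  refine ⟨⟨trivial, by ring⟩, ⟨by ring, by ring⟩, fun i hi => ?_, fun j hj => ?_⟩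
  · obtain ⟨k, rfl⟩ := Nat.exists_eq_add_of_le hi.le
    rw [Nat.add_sub_cancel_left]
    constructor <;> ring
  · obtain ⟨k, rfl⟩ := Nat.exists_eq_add_of_le hj
    rw [Nat.add_sub_cancel_left]
    constructor <;> ring

theorem standardExponents_basisExponents_subset (hh : 0 < h) :
    standardExponents (basisExponents h) ⊆
      {a | (a 2 = 0 ∨ a 3 = 0) ∧ a 1 + a 2 ≤ h ∧ (a 1 + a 3 ≤ h ∨ a 1 = h ∧ a 3 = 1)} := by
  intro a ha
  simp only [standardExponents, Set.mem_ofPred_eq, forall_mem_basisExponents, exponent_le_iff,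
    Nat.zero_le, true_and, and_true] at ha
  obtain ⟨hw, hg_last, hg, hq⟩ := ha
  have h1_le : a 1 ≤ h := by
    have := hq h le_rfl
    omega
  have h12_le : a 1 + a 2 ≤ h := by
    have := hq (a 1 - 1) (by omega)
    omega
  have h3_le : a 3 ≤ h := by
    have := hg 0 hh
    omega
  have h13_le : a 1 + a 3 ≤ h ∨ a 1 = h ∧ a 3 = 1 := by
    have := hg (h + 1 - a 3)
    omega
  exact ⟨by omega, h12_le, h13_le⟩

theorem injOn_imageExponent (hh : 0 < h) :
    Set.InjOn (imageExponent h) (standardExponents (basisExponents h)) := by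
  intro a ha b hb heq
  obtain ⟨heq_s, heq_t⟩ := (imageExponent_eq_iff h).1 heq
  obtain ⟨ha_zero, ha_u, ha_v⟩ := standardExponents_basisExponents_subset hh ha
  obtain ⟨hb_zero, hb_u, hb_v⟩ := standardExponents_basisExponents_subset hh hb
  have remainder_lt {u v : ℕ} (hu : u ≤ h) (hv : v ≤ h + 1) :
      (h + 1) * u + v < (h + 1) ^ 2 + 1 := by
    have := Nat.mul_le_mul_left (h + 1) hu
    linarith
  obtain ⟨h0, huv⟩ := eq_and_eq_of_mul_add_eq_mul_add (remainder_lt ha_u (by omega))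
    (remainder_lt hb_u (by omega)) heq_s
  have hu : a 1 + a 2 = b 1 + b 2 := le_antisymm
    (le_of_mul_add_eq_mul_add (by omega) (by omega) (by omega) huv.symm)
    (le_of_mul_add_eq_mul_add (by omega) (by omega) (by omega) huv)
  have hv : a 1 + a 3 = b 1 + b 3 := by rwa [hu, Nat.add_left_cancel_iff] at huv
  have h1 : a 1 = b 1 := by omega
  have h2 : a 2 = b 2 := by omega
  have h3 : a 3 = b 3 := by omega
  rw [h1, h2, h3, Nat.add_left_cancel_iff] at heq_t
  have h4 : a 4 = b 4 := Nat.eq_of_mul_eq_mul_left (by positivity) heq_t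
  ext i
  fin_cases i <;> assumption

end ArslanCurve

end Arslan

theorem mainTheorem9_general (K : Type*) [Field K] (h : ℕ) (hh : 0 < h) :
    Arslan.IsGroebnerBasis (Arslan.degRevLex Arslan.varOrder) (Arslan.basisSet K h)
      (Arslan.projClosureIdeal K (Arslan.arslanExponents h)) := by
  rw [Arslan.projClosureIdeal_eq_toricIdeal, ← Arslan.image_binomial_basisExponents]
  exact Arslan.isGroebnerBasis_toricIdeal (Arslan.finite_basisExponents h)
    Arslan.snd_lt_fst_of_mem_basisExponents
    Arslan.imageExponent_fst_eq_snd_of_mem_basisExponents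
    (Arslan.injOn_imageExponent hh)

theorem mainTheorem9 (K : Type*) [Field K] (h : ℕ) (hh : 2 ≤ h) :
    Arslan.IsGroebnerBasis (Arslan.degRevLex Arslan.varOrder) (Arslan.basisSet K h)
      (Arslan.projClosureIdeal K (Arslan.arslanExponents h)) :=
  mainTheorem9_general K h (by omega)
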